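/- Let $B_{c_0}$ be the open unit ball of the complex Banach space $c_0$ and identify $c_0^{**}$ with $\ell_\infty$. Let $\mathcal H^\infty(B_{c_0})$ be the algebra of bounded holomorphic functions $f\colon B_{c_0}\to\mathbb C$ and $\mathcal A_u(B_{c_0})$ its subalgebra of uniformly continuous functions, both with the supremum norm. For $\mathcal A$ either algebra let $\mathcal M(\mathcal A)$ be the set of nonzero homomorphisms $\mathcal A\to\mathbb C$, put $$\rho_{\mathcal A}(\varphi,\psi)=\sup\{|\varphi(f)| : f\in\mathcal A,\ \|f\|\le 1,\ \psi(f)=0\},$$ and let the Gleason part of $\varphi\in\mathcal M(\mathcal A)$ be $\mathcal{GP}_{\mathcal A}(\varphi)=\{\psi\in\mathcal M(\mathcal A) : \rho_{\mathcal A}(\varphi,\psi)<1\}$; these sets are the classes of the equivalence relation $\rho_{\mathcal A}(\varphi,\psi)<1$. For $z\in\ell_\infty$ with $\|z\|\le 1$ let $\mathcal M_z(\mathcal H^\infty(B_{c_0}))$ be the set of those $\varphi\in\mathcal M(\mathcal H^\infty(B_{c_0}))$ whose restriction to $c_0^*\subset\mathcal H^\infty(B_{c_0})$ is $z$, and let $\delta_z\in\mathcal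 M(\mathcal A_u(B_{c_0}))$ be $\delta_z(f)=\tilde f(z)$, where $\tilde f$ is the canonical (Aron--Berner) extension of $f$ to the open unit ball of $\ell_\infty$, extended by continuity to the closed ball. Let $z,w\in\ell_\infty$ with $\|z\|=\|w\|=1$ be such that $\delta_z$ and $\delta_w$ lie in the same Gleason part for $\mathcal A_u(B_{c_0})$, that is, $\rho_{\mathcal A_u(B_{c_0})}(\delta_z,\delta_w)<1$. Then there exist $\varphi\in\mathcal M_z(\mathcal H^\infty(B_{c_0}))$ and $\psi\in\mathcal M_w(\mathcal H^\infty(B_{c_0}))$ such that $\mathcal{GP}_{\mathcal H^\infty(B_{c_0})}(\varphi)=\mathcal{GP}_{\mathcal H^\infty(B_{c_0})}(\psi)$. -/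

import Mathlib

open scoped BoundedContinuousFunction ZeroAtInfty ENNReal

noncomputable section

namespace GleasonParts

section General

/-- A function on the open unit ball of `X`, extended by `0` to all of `X`. -/
def extendZero {X : Type*} [NormedAddCommGroup X] (f : Metric.ball (0 : X) 1 → ℂ) : X → ℂ :=
  Function.extend Subtype.val f 0

theorem extendZero_coe {X : Type*} [NormedAddCommGroup X] (f : Metric.ball (0 : X) 1 → ℂ) (x : Metric.ball (0 : X) 1) :
    extendZero f x = f x :=
  Subtype.val_injective.extend_apply f 0 x

theorem uniformContinuous_mul {X : Type*} [NormedAddCommGroup X] {f g : Metric.ball (0 : X) 1 →ᵇ ℂ}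
    (hf : UniformContinuous f) (hg : UniformContinuous g) : UniformContinuous (f * g) := by
  rw [Metric.uniformContinuous_iff] at *
  intro ε hε
  have hC : 0 < ‖f‖ + ‖g‖ + 1 := by positivity
  obtain ⟨a, ha, hfa⟩ := hf (ε / (‖f‖ + ‖g‖ + 1)) (by positivity)
  obtain ⟨b, hb, hgb⟩ := hg (ε / (‖f‖ + ‖g‖ + 1)) (by positivity)
  refine ⟨min a b, lt_min ha hb, fun {x y} hxy => ?_⟩
  have h1 := hfa (hxy.trans_le (min_le_left _ _))
  have h2 := hgb (hxy.trans_le (min_le_right _ _))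
  rw [dist_eq_norm] at h1 h2 ⊢
  have e : (f * g) x - (f * g) y = f x * (g x - g y) + (f x - f y) * g y := by
    simp only [BoundedContinuousFunction.coe_mul, Pi.mul_apply]; ring
  have hd : 0 < ε / (‖f‖ + ‖g‖ + 1) := by positivity
  calc ‖(f * g) x - (f * g) y‖ ≤ ‖f x‖ * ‖g x - g y‖ + ‖f x - f y‖ * ‖g y‖ := by
        rw [e]; exact (norm_add_le _ _).trans (by simp)
    _ ≤ ‖f‖ * (ε / (‖f‖ + ‖g‖ + 1)) + (ε / (‖f‖ + ‖g‖ + 1)) * ‖g‖ := by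
        gcongr
        · exact f.norm_coe_le_norm x
        · exact g.norm_coe_le_norm y
    _ < (‖f‖ + ‖g‖ + 1) * (ε / (‖f‖ + ‖g‖ + 1)) := by nlinarith
    _ = ε := by field_simp

variable {X : Type*} [NormedAddCommGroup X] [NormedSpace ℂ X]

/-- `f : B_X → ℂ` is holomorphic: complex Fréchet differentiable at every point of the open
unit ball. -/
def IsHolomorphic (f : Metric.ball (0 : X) 1 → ℂ) : Prop :=
  DifferentiableOn ℂ (extendZero f) (Metric.ball 0 1)

theorem isHolomorphic_of_eq {f : Metric.ball (0 : X) 1 → ℂ} {F : X → ℂ}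
    (hF : DifferentiableOn ℂ F (Metric.ball 0 1)) (h : ∀ x, f x = F x) : IsHolomorphic f :=
  hF.congr fun x hx => (extendZero_coe f ⟨x, hx⟩).trans (h ⟨x, hx⟩)

variable (X) in
/-- `H^∞(B_X)`: the bounded holomorphic functions on the open unit ball of `X`, with the
supremum norm inherited from the bounded continuous functions. -/
def HInf : Subalgebra ℂ (Metric.ball (0 : X) 1 →ᵇ ℂ) where
  carrier := {f | IsHolomorphic f}
  mul_mem' {f g} hf hg := isHolomorphic_of_eq (DifferentiableOn.mul hf hg) fun x => by
    simp [extendZero_coe]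
  add_mem' {f g} hf hg := isHolomorphic_of_eq (DifferentiableOn.add hf hg) fun x => by
    simp [extendZero_coe]
  algebraMap_mem' c := isHolomorphic_of_eq (F := fun _ => c) (differentiableOn_const c) fun x => by
    simp

variable (X) in
/-- `A_u(B_X)`: the uniformly continuous holomorphic functions on the open unit ball of `X`
(these are automatically bounded), with the supremum norm. -/
def Au : Subalgebra ℂ (Metric.ball (0 : X) 1 →ᵇ ℂ) where
  carrier := {f | f ∈ HInf X ∧ UniformContinuous f}
  mul_mem' hf hg := ⟨mul_mem hf.1 hg.1, uniformContinuous_mul hf.2 hg.2⟩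
  add_mem' hf hg := ⟨add_mem hf.1 hg.1, UniformContinuous.add hf.2 hg.2⟩
  algebraMap_mem' c := ⟨algebraMap_mem _ c, uniformContinuous_const⟩

/-- The spectrum `M(A)`: the nonzero (continuous) multiplicative linear functionals on `A`. -/
abbrev Spectrum (A : Subalgebra ℂ (Metric.ball (0 : X) 1 →ᵇ ℂ)) : Type _ :=
  WeakDual.characterSpace ℂ A

/-- The pseudo-hyperbolic distance
`ρ(φ, ψ) = sup {|φ(f)| : f ∈ A, ‖f‖ ≤ 1, ψ(f) = 0}`, as a supremum in `[0, ∞]`. -/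
def pseudoHyperbolic {A : Subalgebra ℂ (Metric.ball (0 : X) 1 →ᵇ ℂ)} (φ ψ : A → ℂ) : ℝ≥0∞ :=
  ⨆ (f : A) (_ : ‖f‖ ≤ 1) (_ : ψ f = 0), ‖φ f‖ₑ

/-- The Gleason part `GP(φ) = {ψ ∈ M(A) : ρ(φ, ψ) < 1}`. -/
def gleasonPart {A : Subalgebra ℂ (Metric.ball (0 : X) 1 →ᵇ ℂ)} (φ : Spectrum A) :
    Set (Spectrum A) :=
  {ψ | pseudoHyperbolic φ ψ < 1}

/-- The restriction to the open unit ball of a continuous linear functional. -/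
def restrictDual (φ : StrongDual ℂ X) : Metric.ball (0 : X) 1 →ᵇ ℂ :=
  BoundedContinuousFunction.ofNormedAddCommGroup (fun x => φ x)
    (φ.continuous.comp continuous_subtype_val) ‖φ‖ fun x =>
      φ.unit_le_opNorm x (mem_ball_zero_iff.1 x.2).le

theorem restrictDual_mem_HInf (φ : StrongDual ℂ X) : restrictDual φ ∈ HInf X :=
  isHolomorphic_of_eq φ.differentiable.differentiableOn fun _ => rfl

/-- The fiber `M_z(H^∞(B_X))` over `z ∈ X**`: the characters of `H^∞(B_X)` whose restriction
to `X* ⊆ H^∞(B_X)` is `z`. -/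
def fiber (z : StrongDual ℂ (StrongDual ℂ X)) : Set (Spectrum (HInf X)) :=
  {χ | ∀ φ : StrongDual ℂ X, χ ⟨restrictDual φ, restrictDual_mem_HInf φ⟩ = z φ}

/-- The canonical (Arens, Aron-Berner) extension to the bidual of continuous `k`-linear forms,
evaluated at the diagonal point `(z, …, z)`:
`A ↦ z (x₁ ↦ z (x₂ ↦ ⋯ z (x_k ↦ A (x₁, …, x_k))))`. -/
def aronBerner (z : StrongDual ℂ (StrongDual ℂ X)) :
    (k : ℕ) → StrongDual ℂ (X [×k]→L[ℂ] ℂ)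
  | 0 => (continuousMultilinearCurryFin0 ℂ X ℂ : (X [×0]→L[ℂ] ℂ) →L[ℂ] ℂ)
  | k + 1 =>
    (z.comp (ContinuousLinearMap.compL ℂ X (X [×k]→L[ℂ] ℂ) ℂ (aronBerner z k))).comp
      (continuousMultilinearCurryLeftEquiv ℂ (fun _ : Fin (k + 1) => X) ℂ :
        (X [×(k + 1)]→L[ℂ] ℂ) →L[ℂ] (X →L[ℂ] (X [×k]→L[ℂ] ℂ)))

/-- The canonical extension `f̃` of a holomorphic `f : B_X → ℂ` to the open unit ball of `X**`:
the homogeneous Taylor polynomials of `f` at `0` are extended to `X**` and summed. -/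
def canonicalExtension (f : Metric.ball (0 : X) 1 → ℂ) (z : StrongDual ℂ (StrongDual ℂ X)) : ℂ :=
  ∑' k : ℕ, ((k.factorial : ℂ))⁻¹ * aronBerner z k (iteratedFDeriv ℂ k (extendZero f) 0)

/-- The evaluation `δ_z` on `A_u(B_X)` at a point `z` of the closed unit ball of `X**`:
`δ_z(f)` is the value at `z` of the continuous extension of `f̃` from the open to the closed
unit ball of `X**`. -/
def evalAu (z : StrongDual ℂ (StrongDual ℂ X)) (f : Au X) : ℂ :=
  extendFrom (Metric.ball 0 1) (canonicalExtension (f : Metric.ball (0 : X) 1 →ᵇ ℂ)) z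

end General

/-- The unit vector `e_n` of `c₀`. -/
def unitVec (n : ℕ) : C₀(ℕ, ℂ) where
  toFun := (Pi.single n 1 : ℕ → ℂ)
  continuous_toFun := continuous_of_discreteTopology
  zero_at_infty' := by
    rw [Filter.cocompact_eq_cofinite]
    refine tendsto_const_nhds.congr' ?_
    filter_upwards [(Set.finite_singleton n).compl_mem_cofinite] with m hm
    have hmn : m ≠ n := by simpa using hm
    simp [hmn]

theorem sum_norm_apply_unitVec_le (φ : StrongDual ℂ C₀(ℕ, ℂ)) (s : Finset ℕ) :
    ∑ n ∈ s, ‖φ (unitVec n)‖ ≤ ‖φ‖ := by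
  choose c hc using fun n => Complex.exists_norm_eq_mul_self (φ (unitVec n))
  set x : C₀(ℕ, ℂ) := ∑ n ∈ s, c n • unitVec n with hx
  have hx1 : ‖x‖ ≤ 1 := by
    rw [← ZeroAtInftyContinuousMap.norm_toBCF_eq_norm]
    refine (BoundedContinuousFunction.norm_le zero_le_one).2 fun m => ?_
    have hm : x m = if m ∈ s then c m else 0 := by
      have h0 : x m = ∑ n ∈ s, c n * (Pi.single n (1 : ℂ) : ℕ → ℂ) m := by
        have : ∀ t : Finset ℕ, (∑ n ∈ t, c n • unitVec n : C₀(ℕ, ℂ)) m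
            = ∑ n ∈ t, c n * (Pi.single n (1 : ℂ) : ℕ → ℂ) m := by
          intro t
          induction t using Finset.induction_on with
          | empty => simp
          | insert a t ha ih =>
            rw [Finset.sum_insert ha, Finset.sum_insert ha, ← ih]; rfl
        exact this s
      rw [h0]
      simp [Pi.single_apply]
    change ‖x m‖ ≤ 1
    rw [hm]
    split_ifs
    · exact (hc m).1.le
    · simp
  have h : φ x = ((∑ n ∈ s, ‖φ (unitVec n)‖ : ℝ) : ℂ) := by
    rw [hx, map_sum, Complex.ofReal_sum]
    exact Finset.sum_congr rfl fun n _ => by rw [map_smul, smul_eq_mul, (hc n).2]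
  calc ∑ n ∈ s, ‖φ (unitVec n)‖ = ‖φ x‖ := by
        rw [h, Complex.norm_real, Real.norm_of_nonneg (Finset.sum_nonneg fun _ _ => norm_nonneg _)]
    _ ≤ ‖φ‖ := φ.unit_le_opNorm x hx1

theorem summable_norm_apply_unitVec (φ : StrongDual ℂ C₀(ℕ, ℂ)) :
    Summable fun n => ‖φ (unitVec n)‖ :=
  summable_of_sum_le (fun _ => norm_nonneg _) (sum_norm_apply_unitVec_le φ)

theorem norm_apply_unitVec_mul_le (φ : StrongDual ℂ C₀(ℕ, ℂ)) (z : lp (fun _ : ℕ => ℂ) ∞) (n : ℕ) :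
    ‖φ (unitVec n) * z n‖ ≤ ‖φ (unitVec n)‖ * ‖z‖ := by
  rw [norm_mul]
  gcongr
  exact lp.norm_apply_le_norm ENNReal.top_ne_zero z n

theorem summable_apply_unitVec_mul (φ : StrongDual ℂ C₀(ℕ, ℂ)) (z : lp (fun _ : ℕ => ℂ) ∞) :
    Summable fun n => φ (unitVec n) * z n :=
  .of_norm_bounded ((summable_norm_apply_unitVec φ).mul_right ‖z‖) (norm_apply_unitVec_mul_le φ z)

/-- The canonical identification of `ℓ_∞` with the bidual of `c₀`: the sequence `z` acts on
`φ ∈ c₀* = ℓ₁` as `∑ φ(e_n) z_n`. -/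
def toBidual (z : lp (fun _ : ℕ => ℂ) ∞) : StrongDual ℂ (StrongDual ℂ C₀(ℕ, ℂ)) :=
  LinearMap.mkContinuous
    { toFun := fun φ : StrongDual ℂ C₀(ℕ, ℂ) => ∑' n, φ (unitVec n) * z n
      map_add' := fun φ ψ => by
        rw [← (summable_apply_unitVec_mul φ z).tsum_add (summable_apply_unitVec_mul ψ z)]
        exact tsum_congr fun n => add_mul _ _ _
      map_smul' := fun c φ => by
        rw [RingHom.id_apply, smul_eq_mul, ← tsum_mul_left]
        exact tsum_congr fun n => mul_assoc _ _ _ }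
    ‖z‖ fun φ => by
      refine (tsum_of_norm_bounded
        ((summable_norm_apply_unitVec φ).mul_right ‖z‖).hasSum (norm_apply_unitVec_mul_le φ z)).trans ?_
      rw [tsum_mul_right, mul_comm]
      gcongr
      exact Real.tsum_le_of_sum_le (fun _ => norm_nonneg _) (sum_norm_apply_unitVec_le φ)

end GleasonParts

end

/-!
Testing `ρ(δ_z, δ_w) < 1` on functions `G ∘ e_n*`, with `G` in the disc algebra, shows that the
coordinates `z_n` and `w_n` are at pseudo-hyperbolic distance at most some `r < 1`, uniformly in
`n`. By the converse of the Schwarz-Pick lemma there are holomorphic `g_n` from the disc to the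
closed disc with `g_n(0) = w_n` and `g_n(r) = z_n`. The first `k` of them, multiplied by
`k / (k + 1)`, form an analytic disc in the unit ball of `c₀` through truncations `y_k` of `w` and
`x_k` of `z`, so the Schwarz-Pick lemma bounds the pseudo-hyperbolic distance between `f(x_k)` and
`f(y_k)` by `r` for every `f` in the unit ball of `H^∞`. The limits along one common ultrafilter of
the evaluations at `x_k` and at `y_k` are characters over `z` and `w`; they inherit the bound, hence
lie in the same Gleason part.
-/

noncomputable section

namespace GleasonParts

open Filter Metric Set

open scoped ComplexConjugate Topology

section Disc

variable {a b c : ℂ} {r s : ℝ}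

/-- The Möbius transformation `z ↦ (z + b) / (1 + b̄ z)` of the unit disc, which carries `0` to `b`
and has inverse `mobius (-b)`. -/
def mobius (b z : ℂ) : ℂ :=
  (z + b) / (1 + conj b * z)

/-- The pseudo-hyperbolic distance between `a` and `b` is at most `r`. The absence of a quotient
lets the notion make sense on the closed unit disc. -/
def PseudoHypLE (r : ℝ) (a b : ℂ) : Prop :=
  ‖a - b‖ ≤ r * ‖1 - conj b * a‖

theorem norm_one_sub_conj_mul_sq_sub (a b : ℂ) :
    ‖1 - conj b * a‖ ^ 2 - ‖a - b‖ ^ 2 = (1 - ‖a‖ ^ 2) * (1 - ‖b‖ ^ 2) := by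
  simp only [Complex.sq_norm, Complex.normSq_apply, Complex.sub_re, Complex.sub_im,
    Complex.mul_re, Complex.mul_im, Complex.conj_re, Complex.conj_im, Complex.one_re,
    Complex.one_im]
  ring

theorem pseudoHypLE_one (ha : ‖a‖ ≤ 1) (hb : ‖b‖ ≤ 1) : PseudoHypLE 1 a b := by
  have hsq : 0 ≤ (1 - ‖a‖ ^ 2) * (1 - ‖b‖ ^ 2) :=
    mul_nonneg (sub_nonneg.2 (pow_le_one₀ (norm_nonneg a) ha))
      (sub_nonneg.2 (pow_le_one₀ (norm_nonneg b) hb))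
  rw [← norm_one_sub_conj_mul_sq_sub, sub_nonneg] at hsq
  simpa only [PseudoHypLE, one_mul] using le_of_sq_le_sq hsq (norm_nonneg _)

theorem norm_conj_mul_le (hb : ‖b‖ ≤ s) (ha : ‖a‖ ≤ 1) : ‖conj b * a‖ ≤ s := by
  rw [norm_mul, RCLike.norm_conj]
  exact (mul_le_of_le_one_right (norm_nonneg b) ha).trans hb

theorem one_add_conj_mul_ne_zero (hb : ‖b‖ < 1) (ha : ‖a‖ ≤ 1) : 1 + conj b * a ≠ 0 := by
  intro h
  have hone : ‖conj b * a‖ = 1 := by rw [eq_neg_of_add_eq_zero_right h, norm_neg, norm_one]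
  exact (norm_conj_mul_le le_rfl ha).not_gt (hone ▸ hb)

theorem mobius_zero (b : ℂ) : mobius b 0 = b := by
  simp [mobius]

theorem mobius_neg_self (b : ℂ) : mobius (-b) b = 0 := by
  simp [mobius]

theorem norm_mobius_le_one (hb : ‖b‖ < 1) (ha : ‖a‖ ≤ 1) : ‖mobius b a‖ ≤ 1 := by
  rw [mobius, norm_div]
  refine div_le_one_of_le₀ ?_ (norm_nonneg _)
  simpa [PseudoHypLE] using pseudoHypLE_one ha ((norm_neg b).trans_le hb.le)

theorem mobius_mobius_neg (hb : ‖b‖ < 1) (ha : ‖a‖ ≤ 1) : mobius b (mobius (-b) a) = a := by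
  have ha' : 1 - conj b * a ≠ 0 := by
    simpa [sub_eq_add_neg] using one_add_conj_mul_ne_zero ((norm_neg b).trans_lt hb) ha
  have hb' : 1 - conj b * b ≠ 0 := by
    simpa [sub_eq_add_neg] using one_add_conj_mul_ne_zero ((norm_neg b).trans_lt hb) hb.le
  have hnum : (a - b) / (1 - conj b * a) + b
      = a * (1 - conj b * b) / (1 - conj b * a) := by rw [div_add' _ _ _ ha']; congr 1; ring
  have hden : 1 + conj b * ((a - b) / (1 - conj b * a))
      = (1 - conj b * b) / (1 - conj b * a) := by
    rw [mul_div_assoc', add_div' _ _ _ ha']; congr 1; ring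
  simp only [mobius, map_neg, neg_mul, ← sub_eq_add_neg]
  rw [hnum, hden, div_div_div_cancel_right₀ ha', mul_div_cancel_right₀ _ hb']

theorem differentiableOn_mobius (hb : ‖b‖ < 1) :
    DifferentiableOn ℂ (mobius b) (closedBall 0 1) :=
  (differentiableOn_id.add_const b).div ((differentiableOn_id.const_mul _).const_add 1)
    fun _ hz => one_add_conj_mul_ne_zero hb (mem_closedBall_zero_iff.1 hz)

theorem pseudoHypLE_iff_norm_mobius_le (hb : ‖b‖ < 1) (ha : ‖a‖ ≤ 1) :
    PseudoHypLE r a b ↔ ‖mobius (-b) a‖ ≤ r := by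
  have hne := one_add_conj_mul_ne_zero ((norm_neg b).trans_lt hb) ha
  rw [mobius, norm_div, div_le_iff₀ (norm_pos_iff.2 hne)]
  simp only [PseudoHypLE, map_neg, neg_mul, ← sub_eq_add_neg]

theorem PseudoHypLE.symm (h : PseudoHypLE r a b) : PseudoHypLE r b a := by
  have hconj : 1 - conj a * b = conj (1 - conj b * a) := by simp [mul_comm]
  rw [PseudoHypLE, norm_sub_rev, hconj, RCLike.norm_conj]
  exact h

theorem PseudoHypLE.of_tendsto {ι : Type*} {l : Filter ι} [l.NeBot] {f g : ι → ℂ}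
    (hf : Tendsto f l (𝓝 a)) (hg : Tendsto g l (𝓝 b)) (h : ∀ᶠ i in l, PseudoHypLE r (f i) (g i)) :
    PseudoHypLE r a b :=
  le_of_tendsto_of_tendsto (hf.sub hg).norm
    ((((Complex.continuous_conj.tendsto b).comp hg).mul hf).const_sub 1 |>.norm.const_mul r) h

theorem PseudoHypLE.eq_of_norm_eq_one (h : PseudoHypLE r a b) (hr : r < 1) (hb : ‖b‖ = 1) :
    a = b := by
  have hbb : conj b * b = 1 := by rw [Complex.conj_mul', hb]; norm_num
  have hdist : ‖1 - conj b * a‖ = ‖a - b‖ := by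
    rw [← hbb, ← mul_sub, norm_mul, RCLike.norm_conj, hb, one_mul, norm_sub_rev]
  rw [PseudoHypLE, hdist] at h
  refine sub_eq_zero.1 (norm_le_zero_iff.1 ?_)
  nlinarith

theorem PseudoHypLE.norm_sub_norm_le (h : PseudoHypLE r a b) (hr0 : 0 ≤ r) (hr1 : r ≤ 1)
    (ha : ‖a‖ ≤ 1) (hb : ‖b‖ ≤ 1) : ‖a‖ - ‖b‖ ≤ r * (1 - ‖a‖ * ‖b‖) := by
  have hab : ‖b‖ * ‖a‖ ≤ 1 := mul_le_one₀ hb (norm_nonneg a) ha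
  have hsq : ‖a - b‖ ^ 2 ≤ r ^ 2 * ‖1 - conj b * a‖ ^ 2 := by
    rw [← mul_pow]
    exact pow_le_pow_left₀ (norm_nonneg _) h 2
  have hden : (1 - ‖b‖ * ‖a‖) ^ 2 ≤ ‖1 - conj b * a‖ ^ 2 := by
    have := _root_.norm_sub_norm_le (1 : ℂ) (conj b * a)
    rw [norm_one, norm_mul, RCLike.norm_conj] at this
    exact pow_le_pow_left₀ (sub_nonneg.2 hab) this 2
  have hprod : (1 - r ^ 2) * (1 - ‖b‖ * ‖a‖) ^ 2 ≤ (1 - ‖a‖ ^ 2) * (1 - ‖b‖ ^ 2) := by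
    have hr2 : 0 ≤ 1 - r ^ 2 := sub_nonneg.2 (pow_le_one₀ hr0 hr1)
    have hid := norm_one_sub_conj_mul_sq_sub a b
    nlinarith [mul_le_mul_of_nonneg_left hden hr2]
  refine le_of_sq_le_sq ?_ (mul_nonneg hr0 (by linarith))
  linarith

theorem PseudoHypLE.norm_le_add_div (h : PseudoHypLE r a b) (hr0 : 0 ≤ r) (hr1 : r ≤ 1)
    (ha : ‖a‖ ≤ 1) (hb : ‖b‖ ≤ s) (hs : s ≤ 1) : ‖a‖ ≤ (r + s) / (1 + r * s) := by
  have hab := h.norm_sub_norm_le hr0 hr1 ha (hb.trans hs)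
  have hs0 : 0 ≤ s := (norm_nonneg b).trans hb
  have hra : 0 ≤ 1 - r * ‖a‖ := sub_nonneg.2 (mul_le_one₀ hr1 (norm_nonneg a) ha)
  rw [le_div_iff₀ (by positivity)]
  linarith [mul_le_mul_of_nonneg_right hb hra]

theorem pseudoHypLE_of_mapsTo_closedBall {u : ℂ → ℂ} (hu : DifferentiableOn ℂ u (ball 0 1))
    (hmaps : MapsTo u (ball 0 1) (closedBall 0 1)) {x : ℂ} (hx : ‖x‖ < 1) :
    PseudoHypLE ‖x‖ (u x) (u 0) := by
  have h0 : (0 : ℂ) ∈ ball (0 : ℂ) 1 := mem_ball_self one_pos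
  have hx' : x ∈ ball (0 : ℂ) 1 := mem_ball_zero_iff.2 hx
  have hle : ∀ y ∈ ball (0 : ℂ) 1, ‖u y‖ ≤ 1 := fun y hy => mem_closedBall_zero_iff.1 (hmaps hy)
  rcases (hle 0 h0).lt_or_eq with hlt | heq
  · rw [pseudoHypLE_iff_norm_mobius_le hlt (hle x hx')]
    have hneg : ‖-u 0‖ < 1 := (norm_neg _).trans_lt hlt
    exact Complex.norm_le_norm_of_mapsTo_ball (f := mobius (-u 0) ∘ u)
      ((differentiableOn_mobius hneg).comp hu hmaps)
      (fun y hy => mem_closedBall_zero_iff.2 (norm_mobius_le_one hneg (hle y hy)))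
      (mobius_neg_self (u 0)) hx
  · have hmax : IsMaxOn (norm ∘ u) (ball 0 1) 0 := fun y hy => (hle y hy).trans heq.ge
    have hconst : u x = u 0 := Complex.eqOn_of_isPreconnected_of_isMaxOn_norm
      (convex_ball 0 1).isPreconnected isOpen_ball hu h0 hmax hx'
    rw [PseudoHypLE, hconst, sub_self, norm_zero]
    positivity

theorem PseudoHypLE.exists_mapsTo_closedBall (h : PseudoHypLE r a b) (hr0 : 0 < r) (hr1 : r < 1)
    (ha : ‖a‖ ≤ 1) (hb : ‖b‖ ≤ 1) :
    ∃ g : ℂ → ℂ, DifferentiableOn ℂ g (ball 0 1) ∧ MapsTo g (ball 0 1) (closedBall 0 1) ∧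
      g r = a ∧ g 0 = b := by
  rcases hb.lt_or_eq with hlt | heq
  · set c := mobius (-b) a / r with hc
    have hr : (r : ℂ) ≠ 0 := Complex.ofReal_ne_zero.2 hr0.ne'
    have hc1 : ‖c‖ ≤ 1 := by
      rw [hc, norm_div, Complex.norm_of_nonneg hr0.le]
      exact div_le_one_of_le₀ ((pseudoHypLE_iff_norm_mobius_le hlt ha).1 h) hr0.le
    have hmul : MapsTo (fun x => x * c) (ball (0 : ℂ) 1) (closedBall 0 1) := fun x hx =>
      mem_closedBall_zero_iff.2 <| (norm_mul x c).trans_le <|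
        mul_le_one₀ (mem_ball_zero_iff.1 hx).le (norm_nonneg c) hc1
    refine ⟨fun x => mobius b (x * c),
      (differentiableOn_mobius hlt).comp (differentiableOn_id.mul_const c) hmul,
      fun x hx => mem_closedBall_zero_iff.2
        (norm_mobius_le_one hlt (mem_closedBall_zero_iff.1 (hmul hx))), ?_, ?_⟩
    · simp only [hc, mul_div_cancel₀ _ hr, mobius_mobius_neg hlt ha]
    · simp only [zero_mul, mobius_zero]
  · exact ⟨fun _ => b, differentiableOn_const b, fun _ _ => mem_closedBall_zero_iff.2 hb,
      (h.eq_of_norm_eq_one hr1 heq).symm, rfl⟩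

theorem norm_one_sub_le_norm_one_add_sub {ε : ℝ} (hε : 0 ≤ ε) (hc : ‖c‖ ≤ 1) :
    ‖1 - c‖ ≤ ‖1 + ε - c‖ := by
  have hre : c.re ≤ 1 := (Complex.re_le_norm c).trans hc
  refine le_of_sq_le_sq ?_ (norm_nonneg _)
  simp only [Complex.sq_norm, Complex.normSq_apply, Complex.sub_re, Complex.sub_im,
    Complex.add_re, Complex.add_im, Complex.one_re, Complex.one_im, Complex.ofReal_re,
    Complex.ofReal_im]
  nlinarith [mul_nonneg hε (sub_nonneg.2 hre)]

/-- The functions `(x - b) / (1 + ε - b̄ x)` are in the disc algebra even for `|b| = 1`, and they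
recover the pseudo-hyperbolic distance to `b` as `ε → 0`. -/
theorem pseudoHypLE_of_forall_diffContOnCl (ha : ‖a‖ ≤ 1) (hb : ‖b‖ ≤ 1)
    (h : ∀ G : ℂ → ℂ, DiffContOnCl ℂ G (ball 0 1) → MapsTo G (closedBall 0 1) (closedBall 0 1) →
      G b = 0 → ‖G a‖ ≤ r) : PseudoHypLE r a b := by
  have hden : ∀ ε : ℝ, 0 < ε → ∀ x ∈ closedBall (0 : ℂ) 1, 1 + ε - conj b * x ≠ 0 := by
    intro ε hε x hx h0
    have hle := norm_conj_mul_le hb (mem_closedBall_zero_iff.1 hx)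
    rw [← sub_eq_zero.1 h0, ← Complex.ofReal_one, ← Complex.ofReal_add,
      Complex.norm_of_nonneg (by positivity)] at hle
    linarith
  have hle : ∀ ε : ℝ, 0 < ε → ‖a - b‖ ≤ r * ‖1 + ε - conj b * a‖ := by
    intro ε hε
    rw [← div_le_iff₀ (norm_pos_iff.2 (hden ε hε a (mem_closedBall_zero_iff.2 ha))), ← norm_div]
    refine h (fun x => (x - b) / (1 + ε - conj b * x)) (DifferentiableOn.diffContOnCl ?_)
      (fun x hx => ?_) (by simp)
    · rw [closure_ball _ one_ne_zero]
      exact (differentiableOn_id.sub_const b).div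
        ((differentiableOn_id.const_mul _).const_sub _) (hden ε hε)
    · have hx1 := mem_closedBall_zero_iff.1 hx
      rw [mem_closedBall_zero_iff, norm_div]
      refine div_le_one_of_le₀ ?_ (norm_nonneg _)
      calc ‖x - b‖ ≤ ‖1 - conj b * x‖ := by simpa [PseudoHypLE] using pseudoHypLE_one hx1 hb
        _ ≤ ‖1 + ε - conj b * x‖ :=
          norm_one_sub_le_norm_one_add_sub hε.le (norm_conj_mul_le hb hx1)
  have hcont : Continuous fun ε : ℝ => r * ‖1 + ε - conj b * a‖ := by fun_prop
  have hlim : Tendsto (fun ε : ℝ => r * ‖1 + ε - conj b * a‖) (𝓝[>] 0)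
      (𝓝 (r * ‖1 - conj b * a‖)) := by
    simpa only [Complex.ofReal_zero, add_zero] using
      (hcont.tendsto 0).mono_left nhdsWithin_le_nhds
  exact ge_of_tendsto hlim (eventually_mem_nhdsWithin.mono hle)

end Disc

section CharacterSpace

variable {𝕜 A : Type*} [NontriviallyNormedField 𝕜] [NormedRing A] [NormedAlgebra 𝕜 A]

theorem norm_characterSpace_apply_le (χ : WeakDual.characterSpace 𝕜 A) (a : A) :
    ‖χ a‖ ≤ ‖a‖ := by
  by_contra! hlt
  have hχa : χ a ≠ 0 := norm_pos_iff.1 ((norm_nonneg a).trans_lt hlt)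
  set b : A := (χ a)⁻¹ • a with hb
  have hb1 : ‖b‖ < 1 := by
    rw [hb, norm_smul, norm_inv, inv_mul_lt_one₀ (norm_pos_iff.2 hχa)]
    exact hlt
  have hχb : ∀ n, χ (b ^ n) = 1 := fun n => by
    rw [map_pow, hb, map_smul, smul_eq_mul, inv_mul_cancel₀ hχa, one_pow]
  have hlim : Tendsto (fun n => χ (b ^ n)) atTop (𝓝 (χ 0)) :=
    ((map_continuous χ).tendsto 0).comp (tendsto_pow_atTop_nhds_zero_of_norm_lt_one hb1)
  simp only [hχb, map_zero] at hlim
  exact one_ne_zero (tendsto_nhds_unique tendsto_const_nhds hlim)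

theorem compactSpace_characterSpace [ProperSpace 𝕜] :
    CompactSpace (WeakDual.characterSpace 𝕜 A) := by
  refine isCompact_iff_compactSpace.1 <|
    (WeakDual.isCompact_closedBall (0 : StrongDual 𝕜 A) 1).of_isClosed_subset
      WeakDual.CharacterSpace.isClosed fun χ hχ => ?_
  refine mem_closedBall_zero_iff.2 (ContinuousLinearMap.opNorm_le_bound _ zero_le_one fun a => ?_)
  rw [one_mul]
  exact norm_characterSpace_apply_le ⟨χ, hχ⟩ a

variable {Y : Type*} [TopologicalSpace Y]

/-- Evaluation at a point, as a character of an algebra of bounded continuous functions. -/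
def pointEval (A : Subalgebra ℂ (Y →ᵇ ℂ)) (y : Y) : WeakDual.characterSpace ℂ A :=
  ⟨StrongDual.toWeakDual
      ((BoundedContinuousFunction.evalCLM ℂ y).comp (Subalgebra.toSubmodule A).subtypeL),
    WeakDual.CharacterSpace.eq_set_map_one_map_mul.ge ⟨rfl, fun _ _ => rfl⟩⟩

theorem exists_tendsto_ultrafilter (A : Subalgebra ℂ (Y →ᵇ ℂ)) {ι : Type*} (U : Ultrafilter ι)
    (y : ι → Y) :
    ∃ χ : WeakDual.characterSpace ℂ A, ∀ f : A,
      Tendsto (fun i => (f : Y →ᵇ ℂ) (y i)) U (𝓝 (χ f)) := by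
  have := compactSpace_characterSpace (𝕜 := ℂ) (A := A)
  obtain ⟨χ, -, hχ⟩ := isCompact_univ.ultrafilter_le_nhds
    (U.map fun i => pointEval A (y i)) (by simp)
  exact ⟨χ, fun f => ((WeakDual.eval_continuous f).comp continuous_subtype_val).tendsto χ
    |>.comp hχ⟩

end CharacterSpace

section GleasonPart

variable {X : Type*} [NormedAddCommGroup X] {A : Subalgebra ℂ (ball (0 : X) 1 →ᵇ ℂ)}

theorem pseudoHyperbolic_le_ofReal_iff {φ ψ : A → ℂ} {r : ℝ} (hr : 0 ≤ r) :
    pseudoHyperbolic φ ψ ≤ ENNReal.ofReal r ↔ ∀ f : A, ‖f‖ ≤ 1 → ψ f = 0 → ‖φ f‖ ≤ r := by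
  simp only [pseudoHyperbolic, iSup_le_iff, ← ofReal_norm, ENNReal.ofReal_le_ofReal_iff hr]

theorem exists_pseudoHyperbolic_le_ofReal {φ ψ : A → ℂ} (h : pseudoHyperbolic φ ψ < 1) :
    ∃ r : ℝ, 0 < r ∧ r < 1 ∧ pseudoHyperbolic φ ψ ≤ ENNReal.ofReal r := by
  obtain ⟨r, hr, hr1⟩ := ENNReal.lt_iff_exists_nnreal_btwn.1 h
  exact ⟨r, NNReal.coe_pos.2 (ENNReal.coe_pos.1 (pos_of_gt hr)), by exact_mod_cast hr1,
    by simpa using hr.le⟩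

theorem gleasonPart_subset_of_pseudoHypLE {φ ψ : Spectrum A} {r : ℝ} (hr0 : 0 ≤ r) (hr1 : r < 1)
    (h : ∀ f : A, ‖f‖ ≤ 1 → PseudoHypLE r (ψ f) (φ f)) : gleasonPart φ ⊆ gleasonPart ψ := by
  intro χ hχ
  obtain ⟨s, hs0, hs1, hs⟩ := exists_pseudoHyperbolic_le_ofReal hχ
  rw [pseudoHyperbolic_le_ofReal_iff hs0.le] at hs
  have hle : pseudoHyperbolic ψ χ ≤ ENNReal.ofReal ((r + s) / (1 + r * s)) :=
    (pseudoHyperbolic_le_ofReal_iff (by positivity)).2 fun f hf hχf =>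
      (h f hf).norm_le_add_div hr0 hr1.le ((norm_characterSpace_apply_le ψ f).trans hf)
        (hs f hf hχf) hs1.le
  have hlt : (r + s) / (1 + r * s) < 1 := by
    rw [div_lt_one (by positivity)]
    nlinarith [mul_pos (sub_pos.2 hr1) (sub_pos.2 hs1)]
  exact hle.trans_lt (ENNReal.ofReal_lt_one.2 hlt)

theorem gleasonPart_eq_of_pseudoHypLE {φ ψ : Spectrum A} {r : ℝ} (hr0 : 0 ≤ r) (hr1 : r < 1)
    (h : ∀ f : A, ‖f‖ ≤ 1 → PseudoHypLE r (φ f) (ψ f)) : gleasonPart φ = gleasonPart ψ :=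
  (gleasonPart_subset_of_pseudoHypLE hr0 hr1 fun f hf => (h f hf).symm).antisymm
    (gleasonPart_subset_of_pseudoHypLE hr0 hr1 h)

end GleasonPart

section CanonicalExtension

variable {X : Type*} [NormedAddCommGroup X] [NormedSpace ℂ X]

/-- The `k`-linear form `(x₁, …, x_k) ↦ φ(x₁) ⋯ φ(x_k)`, from which the Taylor polynomials of
`G ∘ φ` are built. -/
def dualPow (φ : StrongDual ℂ X) (k : ℕ) : X [×k]→L[ℂ] ℂ :=
  (ContinuousMultilinearMap.mkPiAlgebra ℂ (Fin k) ℂ).compContinuousLinearMap fun _ => φ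

theorem dualPow_apply (φ : StrongDual ℂ X) (k : ℕ) (m : Fin k → X) :
    dualPow φ k m = ∏ i, φ (m i) := by
  simp [dualPow]

theorem curryLeft_dualPow_succ (φ : StrongDual ℂ X) (k : ℕ) :
    (dualPow φ (k + 1)).curryLeft = φ.smulRight (dualPow φ k) := by
  ext x m
  simp [dualPow_apply, Fin.prod_univ_succ]

theorem aronBerner_dualPow (z : StrongDual ℂ (StrongDual ℂ X)) (φ : StrongDual ℂ X) (k : ℕ) :
    aronBerner z k (dualPow φ k) = z φ ^ k := by
  induction k with
  | zero => simp [aronBerner, dualPow_apply]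
  | succ k ih =>
    have hcomp : (aronBerner z k).comp (φ.smulRight (dualPow φ k)) = z φ ^ k • φ := by
      ext x
      simp [ih, mul_comm]
    calc aronBerner z (k + 1) (dualPow φ (k + 1))
        = z ((aronBerner z k).comp (dualPow φ (k + 1)).curryLeft) := rfl
      _ = z φ ^ (k + 1) := by
        rw [curryLeft_dualPow_succ, hcomp, map_smul, smul_eq_mul, pow_succ]

theorem iteratedFDeriv_comp_dual {G : ℂ → ℂ} {r : ℝ} (hr : 0 < r)
    (hG : DifferentiableOn ℂ G (ball 0 r)) (φ : StrongDual ℂ X) (k : ℕ) :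
    iteratedFDeriv ℂ k (G ∘ φ) 0 = iteratedDeriv k G 0 • dualPow φ k := by
  have hopen : IsOpen (φ ⁻¹' ball (0 : ℂ) r) := isOpen_ball.preimage φ.continuous
  have h0 : φ 0 ∈ ball (0 : ℂ) r := by simpa using hr
  have hcomp := φ.iteratedFDerivWithin_comp_right (hG.contDiffOn isOpen_ball (n := k))
    isOpen_ball.uniqueDiffOn hopen.uniqueDiffOn (x := 0) h0 le_rfl
  rw [iteratedFDerivWithin_of_isOpen k hopen h0, iteratedFDerivWithin_of_isOpen k isOpen_ball h0]
    at hcomp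
  ext m
  simp [hcomp, dualPow_apply, iteratedFDeriv_apply_eq_iteratedDeriv_mul_prod, mul_comm]

theorem canonicalExtension_comp_dual {f : ball (0 : X) 1 → ℂ} {G : ℂ → ℂ} {r : ℝ}
    (hG : DifferentiableOn ℂ G (ball 0 r)) {φ : StrongDual ℂ X} (hf : ∀ x, f x = G (φ x))
    {z : StrongDual ℂ (StrongDual ℂ X)} (hz : ‖z φ‖ < r) :
    canonicalExtension f z = G (z φ) := by
  have hr : 0 < r := (norm_nonneg _).trans_lt hz
  have hloc : extendZero f =ᶠ[𝓝 0] G ∘ φ := by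
    filter_upwards [ball_mem_nhds (0 : X) one_pos] with x hx
    exact (extendZero_coe f ⟨x, hx⟩).trans (hf ⟨x, hx⟩)
  rw [← Complex.taylorSeries_eq_on_ball' (mem_ball_zero_iff.2 hz) hG]
  refine tsum_congr fun k => ?_
  rw [(hloc.iteratedFDeriv ℂ k).eq_of_nhds, iteratedFDeriv_comp_dual hr hG, map_smul,
    aronBerner_dualPow, sub_zero, smul_eq_mul, mul_assoc]

theorem mapsTo_dual_ball {φ : StrongDual ℂ X} (hφ : ‖φ‖ ≤ 1) :
    MapsTo φ (ball 0 1) (ball 0 1) := fun x hx =>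
  mem_ball_zero_iff.2 <|
    ((φ.le_opNorm x).trans (mul_le_of_le_one_left (norm_nonneg x) hφ)).trans_lt
      (mem_ball_zero_iff.1 hx)

variable {G : ℂ → ℂ} {φ : StrongDual ℂ X}

theorem evalAu_comp_dual (hG : DiffContOnCl ℂ G (ball 0 1)) (hφ : ‖φ‖ ≤ 1) {f : Au X}
    (hf : ∀ x, (f : ball (0 : X) 1 →ᵇ ℂ) x = G (φ x)) {z : StrongDual ℂ (StrongDual ℂ X)}
    (hz : ‖z‖ ≤ 1) : evalAu z f = G (z φ) := by
  have hball : MapsTo (fun y : StrongDual ℂ (StrongDual ℂ X) => y φ) (ball 0 1) (ball 0 1) :=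
    fun y hy => mem_ball_zero_iff.2 <| (y.unit_le_opNorm φ hφ).trans_lt (mem_ball_zero_iff.1 hy)
  have hclosedBall :
      MapsTo (fun y : StrongDual ℂ (StrongDual ℂ X) => y φ) (closedBall 0 1) (closedBall 0 1) :=
    fun y hy => mem_closedBall_zero_iff.2 <|
      (y.unit_le_opNorm φ hφ).trans (mem_closedBall_zero_iff.1 hy)
  have hz' : z ∈ closedBall (0 : StrongDual ℂ (StrongDual ℂ X)) 1 :=
    (mem_closedBall_zero_iff (a := z)).2 hz
  have hcont : ContinuousOn (fun y : StrongDual ℂ (StrongDual ℂ X) => G (y φ)) (closedBall 0 1) :=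
    hG.continuousOn_ball.comp (ContinuousLinearMap.apply ℂ ℂ φ).continuous.continuousOn hclosedBall
  refine extendFrom_eq (by rwa [closure_ball (E := StrongDual ℂ (StrongDual ℂ X)) 0 one_ne_zero]) ?_
  refine ((hcont z hz').mono ball_subset_closedBall).tendsto.congr' ?_
  filter_upwards [self_mem_nhdsWithin] with y hy
  exact (canonicalExtension_comp_dual hG.differentiableOn hf
    (mem_ball_zero_iff.1 (hball hy))).symm

theorem exists_Au_comp_dual (hG : DiffContOnCl ℂ G (ball 0 1)) {C : ℝ}
    (hC : ∀ x ∈ closedBall (0 : ℂ) 1, ‖G x‖ ≤ C) (hφ : ‖φ‖ ≤ 1) :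
    ∃ f : Au X, ‖f‖ ≤ C ∧ ∀ x, (f : ball (0 : X) 1 →ᵇ ℂ) x = G (φ x) := by
  have hmaps : MapsTo φ (ball 0 1) (ball 0 1) := mapsTo_dual_ball hφ
  have hunif : UniformContinuous fun x : ball (0 : X) 1 => G (φ x) :=
    ((isCompact_closedBall (0 : ℂ) 1).uniformContinuousOn_of_continuous hG.continuousOn_ball
      |> uniformContinuousOn_iff_restrict.1).comp
      ((φ.uniformContinuous.comp uniformContinuous_subtype_val).subtype_mk
        fun x => ball_subset_closedBall (hmaps x.2))
  have hbound : ∀ x : ball (0 : X) 1, ‖G (φ x)‖ ≤ C := fun x =>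
    hC _ (ball_subset_closedBall (hmaps x.2))
  have hC0 : 0 ≤ C := (norm_nonneg (G 0)).trans (hC 0 (mem_closedBall_self zero_le_one))
  exact ⟨⟨BoundedContinuousFunction.ofNormedAddCommGroup _ hunif.continuous C hbound,
      isHolomorphic_of_eq
        (hG.differentiableOn.comp φ.differentiable.differentiableOn hmaps) fun _ => rfl, hunif⟩,
    (BoundedContinuousFunction.norm_le hC0).2 hbound, fun _ => rfl⟩

theorem pseudoHypLE_apply_of_pseudoHyperbolic_le {z w : StrongDual ℂ (StrongDual ℂ X)}
    (hz : ‖z‖ ≤ 1) (hw : ‖w‖ ≤ 1) {r : ℝ} (hr : 0 ≤ r)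
    (h : pseudoHyperbolic (evalAu z) (evalAu w) ≤ ENNReal.ofReal r) (hφ : ‖φ‖ ≤ 1) :
    PseudoHypLE r (z φ) (w φ) := by
  rw [pseudoHyperbolic_le_ofReal_iff hr] at h
  have hle : ∀ y : StrongDual ℂ (StrongDual ℂ X), ‖y‖ ≤ 1 → ‖y φ‖ ≤ 1 := fun y hy =>
    (y.unit_le_opNorm φ hφ).trans hy
  refine pseudoHypLE_of_forall_diffContOnCl (hle z hz) (hle w hw) fun G hG hG1 hGw => ?_
  obtain ⟨f, hf1, hf⟩ :=
    exists_Au_comp_dual hG (fun x hx => mem_closedBall_zero_iff.1 (hG1 hx)) hφ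
  rw [← evalAu_comp_dual hG hφ hf hz]
  exact h f hf1 ((evalAu_comp_dual hG hφ hf hw).trans hGw)

end CanonicalExtension

section Fiber

variable {X : Type*} [NormedAddCommGroup X] [NormedSpace ℂ X]

theorem pseudoHypLE_apply_of_disc {f : HInf X} (hf : ‖f‖ ≤ 1) {u : ℂ → X}
    (hu : DifferentiableOn ℂ u (ball 0 1)) (hmaps : MapsTo u (ball 0 1) (ball 0 1))
    {x y : ball (0 : X) 1} {ζ : ℂ} (hζ : ‖ζ‖ < 1) (hx : u ζ = x) (hy : u 0 = y) :
    PseudoHypLE ‖ζ‖ ((f : ball (0 : X) 1 →ᵇ ℂ) x) ((f : ball (0 : X) 1 →ᵇ ℂ) y) := by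
  set F := extendZero (f : ball (0 : X) 1 →ᵇ ℂ)
  have hF : ∀ v ∈ ball (0 : X) 1, ‖F v‖ ≤ 1 := fun v hv => by
    rw [show F v = _ from extendZero_coe _ ⟨v, hv⟩]
    exact (BoundedContinuousFunction.norm_coe_le_norm _ _).trans hf
  have hpick := pseudoHypLE_of_mapsTo_closedBall (DifferentiableOn.comp f.2 hu hmaps)
    (fun v hv => mem_closedBall_zero_iff.2 (hF _ (hmaps hv))) hζ
  simpa only [Function.comp_apply, hx, hy, extendZero_coe] using hpick

theorem exists_fiber_gleasonPart_eq_of_tendsto {ι : Type*} {l : Filter ι} [l.NeBot]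
    {x y : ι → ball (0 : X) 1} {z w : StrongDual ℂ (StrongDual ℂ X)}
    (hx : ∀ η : StrongDual ℂ X, Tendsto (fun i => η (x i)) l (𝓝 (z η)))
    (hy : ∀ η : StrongDual ℂ X, Tendsto (fun i => η (y i)) l (𝓝 (w η)))
    {r : ℝ} (hr0 : 0 ≤ r) (hr1 : r < 1)
    (h : ∀ f : HInf X, ‖f‖ ≤ 1 → ∀ᶠ i in l,
      PseudoHypLE r ((f : ball (0 : X) 1 →ᵇ ℂ) (x i)) ((f : ball (0 : X) 1 →ᵇ ℂ) (y i))) :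
    ∃ φ ∈ fiber z, ∃ ψ ∈ fiber w, gleasonPart φ = gleasonPart ψ := by
  have hU : (Ultrafilter.of l : Filter ι) ≤ l := Ultrafilter.of_le l
  obtain ⟨φ, hφ⟩ := exists_tendsto_ultrafilter (HInf X) (Ultrafilter.of l) x
  obtain ⟨ψ, hψ⟩ := exists_tendsto_ultrafilter (HInf X) (Ultrafilter.of l) y
  exact ⟨φ, fun η => tendsto_nhds_unique (hφ _) ((hx η).mono_left hU),
    ψ, fun η => tendsto_nhds_unique (hψ _) ((hy η).mono_left hU),
    gleasonPart_eq_of_pseudoHypLE hr0 hr1 fun f hf => .of_tendsto (hφ f) (hψ f) (hU (h f hf))⟩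

end Fiber

section NullSequences

set_option maxSynthPendingDepth 3 in
theorem norm_toBidual_le (z : lp (fun _ : ℕ => ℂ) ∞) : ‖toBidual z‖ ≤ ‖z‖ :=
  LinearMap.mkContinuous_norm_le _ (norm_nonneg z) _

/-- The `n`-th coordinate functional on `c₀`. -/
def coord (n : ℕ) : StrongDual ℂ C₀(ℕ, ℂ) :=
  LinearMap.mkContinuous
    { toFun := fun x => x n
      map_add' := fun _ _ => rfl
      map_smul' := fun _ _ => rfl } 1 fun x => by
    rw [one_mul, ← ZeroAtInftyContinuousMap.norm_toBCF_eq_norm]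
    exact x.toBCF.norm_coe_le_norm n

theorem norm_coord_le (n : ℕ) : ‖coord n‖ ≤ 1 :=
  LinearMap.mkContinuous_norm_le _ zero_le_one _

theorem coord_unitVec (m n : ℕ) : coord m (unitVec n) = (Pi.single n 1 : ℕ → ℂ) m :=
  rfl

theorem toBidual_coord (z : lp (fun _ : ℕ => ℂ) ∞) (n : ℕ) : toBidual z (coord n) = z n := by
  change ∑' m, coord n (unitVec m) * z m = z n
  rw [tsum_eq_single n fun m hm => by simp [coord_unitVec, hm.symm]]
  simp [coord_unitVec]

/-- The vector of `c₀` whose first `k` coordinates are those of `s` and whose other coordinates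
vanish. -/
def truncation (s : ℕ → ℂ) (k : ℕ) : C₀(ℕ, ℂ) :=
  ∑ n ∈ Finset.range k, s n • unitVec n

theorem truncation_apply (s : ℕ → ℂ) (k m : ℕ) :
    truncation s k m = if m < k then s m else 0 := by
  change coord m (truncation s k) = _
  simp [truncation, coord_unitVec, Pi.single_apply]

theorem norm_truncation_le {s : ℕ → ℂ} {M : ℝ} (hM : 0 ≤ M) (hs : ∀ n, ‖s n‖ ≤ M) (k : ℕ) :
    ‖truncation s k‖ ≤ M := by
  rw [← ZeroAtInftyContinuousMap.norm_toBCF_eq_norm]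
  refine (BoundedContinuousFunction.norm_le hM).2 fun m => ?_
  change ‖truncation s k m‖ ≤ M
  rw [truncation_apply]
  split_ifs
  · exact hs m
  · simpa using hM

theorem tendsto_apply_truncation (z : lp (fun _ : ℕ => ℂ) ∞) (η : StrongDual ℂ C₀(ℕ, ℂ)) :
    Tendsto (fun k => η (truncation z k)) atTop (𝓝 (toBidual z η)) := by
  refine (summable_apply_unitVec_mul η z).hasSum.tendsto_sum_nat.congr fun k => ?_
  simp only [truncation, map_sum, map_smul, smul_eq_mul, mul_comm]

/-- The truncation of `s` to its first `k` coordinates, shrunk by the factor `k / (k + 1)` so that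
it lies in the open unit ball. -/
def ballTruncation {s : ℕ → ℂ} (hs : ∀ n, ‖s n‖ ≤ 1) (k : ℕ) : ball (0 : C₀(ℕ, ℂ)) 1 :=
  ⟨(k / (k + 1) : ℝ) • truncation s k, by
    rw [mem_ball_zero_iff, norm_smul, Real.norm_of_nonneg (by positivity)]
    refine (mul_le_of_le_one_right (by positivity)
      (norm_truncation_le zero_le_one hs k)).trans_lt ?_
    rw [div_lt_one (by positivity)]
    exact lt_add_one _⟩

theorem tendsto_apply_ballTruncation {z : lp (fun _ : ℕ => ℂ) ∞} (hz : ∀ n, ‖z n‖ ≤ 1)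
    (η : StrongDual ℂ C₀(ℕ, ℂ)) :
    Tendsto (fun k => η (ballTruncation hz k)) atTop (𝓝 (toBidual z η)) := by
  have hlim := (tendsto_natCast_div_add_atTop (𝕜 := ℝ) 1).smul (tendsto_apply_truncation z η)
  rw [one_smul] at hlim
  exact hlim.congr fun k => ((η.restrictScalars ℝ).map_smul _ _).symm

theorem pseudoHypLE_apply_ballTruncation {f : HInf C₀(ℕ, ℂ)} (hf : ‖f‖ ≤ 1) {z w : ℕ → ℂ}
    (hz : ∀ n, ‖z n‖ ≤ 1) (hw : ∀ n, ‖w n‖ ≤ 1) {r : ℝ} (hr0 : 0 < r) (hr1 : r < 1)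
    (hzw : ∀ n, PseudoHypLE r (z n) (w n)) (k : ℕ) :
    PseudoHypLE r ((f : ball (0 : C₀(ℕ, ℂ)) 1 →ᵇ ℂ) (ballTruncation hz k))
      ((f : ball (0 : C₀(ℕ, ℂ)) 1 →ᵇ ℂ) (ballTruncation hw k)) := by
  choose g hgd hgm hgr hg0 using fun n => (hzw n).exists_mapsTo_closedBall hr0 hr1 (hz n) (hw n)
  have hd : DifferentiableOn ℂ
      (fun x => (k / (k + 1) : ℝ) • truncation (fun n => g n x) k) (ball 0 1) :=
    DifferentiableOn.fun_const_smul (R := ℝ)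
      (DifferentiableOn.fun_sum fun n _ => (hgd n).smul_const (unitVec n)) _
  have hmaps : MapsTo (fun x => (k / (k + 1) : ℝ) • truncation (fun n => g n x) k)
      (ball 0 1) (ball 0 1) := fun x hx =>
    (ballTruncation (fun n => mem_closedBall_zero_iff.1 (hgm n hx)) k).2
  have hnorm : ‖(r : ℂ)‖ = r := Complex.norm_of_nonneg hr0.le
  rw [← hnorm]
  exact pseudoHypLE_apply_of_disc hf hd hmaps (hnorm.trans_lt hr1)
    (by simp only [hgr, ballTruncation]) (by simp only [hg0, ballTruncation])

end NullSequences

end GleasonParts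

end

open GleasonParts in
theorem mainTheorem6_general (z w : lp (fun _ : ℕ => ℂ) ∞) (hz : ‖z‖ ≤ 1) (hw : ‖w‖ ≤ 1)
    (h : pseudoHyperbolic (evalAu (toBidual z)) (evalAu (toBidual w)) < 1) :
    ∃ φ ∈ fiber (toBidual z), ∃ ψ ∈ fiber (toBidual w), gleasonPart φ = gleasonPart ψ := by
  obtain ⟨r, hr0, hr1, hr⟩ := exists_pseudoHyperbolic_le_ofReal h
  have hzn : ∀ n, ‖z n‖ ≤ 1 := fun n => (lp.norm_apply_le_norm ENNReal.top_ne_zero z n).trans hz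
  have hwn : ∀ n, ‖w n‖ ≤ 1 := fun n => (lp.norm_apply_le_norm ENNReal.top_ne_zero w n).trans hw
  have hzw : ∀ n, PseudoHypLE r (z n) (w n) := fun n => by
    simpa only [toBidual_coord] using pseudoHypLE_apply_of_pseudoHyperbolic_le
      ((norm_toBidual_le z).trans hz) ((norm_toBidual_le w).trans hw) hr0.le hr (norm_coord_le n)
  exact exists_fiber_gleasonPart_eq_of_tendsto (tendsto_apply_ballTruncation hzn)
    (tendsto_apply_ballTruncation hwn) hr0.le hr1 fun f hf =>
      .of_forall (pseudoHypLE_apply_ballTruncation hf hzn hwn hr0 hr1 hzw)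

theorem mainTheorem6 (z w : lp (fun _ : ℕ => ℂ) ∞) (hz : ‖z‖ = 1) (hw : ‖w‖ = 1)
    (h : GleasonParts.pseudoHyperbolic
      (GleasonParts.evalAu (GleasonParts.toBidual z))
      (GleasonParts.evalAu (GleasonParts.toBidual w)) < 1) :
    ∃ φ ∈ GleasonParts.fiber (GleasonParts.toBidual z),
      ∃ ψ ∈ GleasonParts.fiber (GleasonParts.toBidual w),
        GleasonParts.gleasonPart φ = GleasonParts.gleasonPart ψ :=
  mainTheorem6_general z w hz.le hw.le h
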